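/- Let $m\ge 1$ and $t\ge s\ge 1$ be integers, and let $\varphi$ be the morphism of the free monoid over the alphabet $\mathcal A=\{0,1,\dots,m-1\}$ given by $\varphi(k)=0^t(k+1)$ for $0\le k<m-1$ and $\varphi(m-1)=0^s$, extended to right infinite words by $\varphi(u_0u_1u_2\cdots)=\varphi(u_0)\varphi(u_1)\varphi(u_2)\cdots$. Then there is exactly one right infinite word $u=u_0u_1u_2\cdots$ over $\mathcal A$ with $\varphi(u)=u$. (For $m\ge 2$ it is the word $u_\beta$ of the confluent Pisot number $\beta>1$ whose Rényi expansion of $1$ is $d_\beta(1)=t\cdots t\,s$, with $m-1$ digits $t$.) Let $\mathcal C(n)$ be the number of distinct factors of $u$ of length $n$, i.e. of finite words $u_iu_{i+1}\cdots u_{i+n-1}$ with $i\ge 0$, and let $\mathcal P(n)$ be the number of those among them that are palindromes, i.e. equal to their reversal. Then for all integers $n\ge 0$, $$\mathcal P(n+1)+\mathcal P(n)=\mathcal C(n+1)-\mathcal C(n)+2 .$$ -/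

import Mathlib

namespace SubstWord

/-- The images of the letters of the alphabet `{0, …, m-1}` under the morphism
`φ(k) = 0^t (k+1)` for `k < m-1` and `φ(m-1) = 0^s`. -/
def phi (m t s : ℕ) [NeZero m] (k : Fin m) : List (Fin m) :=
  if h : (k : ℕ) + 1 < m then List.replicate t 0 ++ [⟨(k : ℕ) + 1, h⟩]
  else List.replicate s 0

/-- The morphism of the free monoid of finite words that is determined by
its values `σ` on the letters. -/
def morphism {A : Type*} (σ : A → List A) (w : List A) : List A :=
  w.flatMap σ

/-- The prefix `u₀ u₁ ⋯ uₙ₋₁` of length `n` of the right infinite word `u`. -/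
def pref {A : Type*} (u : ℕ → A) (n : ℕ) : List A :=
  (List.range n).map u

/-- The right infinite word `u` satisfies `φ(u) = u`, that is `φ(u₀) φ(u₁) φ(u₂) ⋯ = u`:
each finite product `φ(u₀) ⋯ φ(uₙ₋₁)` is a prefix of `u`. (For a non-erasing morphism the
lengths of these products are unbounded, so that they determine the infinite word `φ(u)`.) -/
def IsFixedPoint {A : Type*} (σ : A → List A) (u : ℕ → A) : Prop :=
  ∀ n : ℕ, morphism σ (pref u n) = pref u (morphism σ (pref u n)).length

/-- The set of all (finite) factors of the right infinite word `u`. -/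
def language {A : Type*} (u : ℕ → A) : Set (List A) :=
  {w | ∃ i : ℕ, w = (List.range w.length).map (fun j => u (i + j))}

/-- The set of all palindromes among the factors of `u`. -/
def palindromes {A : Type*} (u : ℕ → A) : Set (List A) :=
  {w | w ∈ language u ∧ w.reverse = w}

/-- The factor complexity `C(n)` of `u`. -/
noncomputable def factorComplexity {A : Type*} (u : ℕ → A) (n : ℕ) : ℕ :=
  Set.ncard {w : List A | w ∈ language u ∧ w.length = n}

/-- The palindromic complexity `P(n)` of `u`. -/
noncomputable def palindromicComplexity {A : Type*} (u : ℕ → A) (n : ℕ) : ℕ :=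
  Set.ncard {w : List A | w ∈ palindromes u ∧ w.length = n}

end SubstWord

/-!
For a factor `w` of `u` let `E(w)` be the set of pairs of letters `(a, b)` such that `awb` is a
factor. Summing over the factors `w` of length `n`, the second difference of `C` at `n` is the sum
of the bilateral multiplicities `#E(w) - #left(w) - #right(w) + 1`, and `P(n+2) - P(n)` is the sum
over the palindromes `w` of the number of `a` with `(a, a) ∈ E(w)`, minus one. The identity holds at
`n = 0`, so it suffices that the two contributions of each factor agree, which is called `Balanced`
below (`palindromicComplexity_add_of_balanced`).

The language is closed under reversal, since `v ↦ φ(v) 0^t` preserves palindromes and the language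
(`reverse_morphism_phi`, `reverse_mem_language`). Hence a factor that is not bispecial is balanced
for purely combinatorial reasons. A factor `0^r` is balanced by computing `E(0^r)`: a maximal run of
zeros between nonzero letters `a` and `b` has length `t`, with `a = 1` or `b = 1`, or length
`t + s`, with `a = b = 1` (`balanced_replicate`). A bispecial factor `w` that contains a nonzero
letter begins and ends with exactly `t` zeros, so `w = φ(v) 0^t` with a shorter factor `v`. The
word `φ(v) 0^t` is followed by `b + 1` if `v` is followed by `b`, and preceded by `a + 1` if `v` is
preceded by `a` (modulo `m`). This makes `E(w)` the translate of `E(v)` (`ext_morphism_append`), while `w` is a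
palindrome exactly when `v` is, and induction on the length applies (`balanced_ext`).

Existence and uniqueness of the fixed point follow from the prefixes `φⁿ(0)`, whose length is
unbounded for `m ≥ 2`. The alphabet with one letter is treated separately.
-/

namespace SubstWord

/-! ### Occurrences and factors -/

section Occurrences

variable {A : Type*} {u : ℕ → A}

/-- The word `w` occurs in `u` at position `i`. -/
def Occ (u : ℕ → A) (i : ℕ) (w : List A) : Prop :=
  w = (List.range w.length).map (fun j => u (i + j))

theorem mem_language_iff {w : List A} : w ∈ language u ↔ ∃ i, Occ u i w := Iff.rfl

@[simp] theorem occ_nil (i : ℕ) : Occ u i [] := by simp [Occ]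

@[simp] theorem occ_cons {i : ℕ} {a : A} {w : List A} :
    Occ u i (a :: w) ↔ u i = a ∧ Occ u (i + 1) w := by
  simp only [Occ, List.length_cons, List.range_succ_eq_map, List.map_cons, List.map_map,
    List.cons.injEq, Nat.add_zero]
  have : (fun j => u (i + j)) ∘ Nat.succ = fun j => u (i + 1 + j) := by
    funext j
    simp [Nat.add_comm, Nat.add_left_comm]
  rw [this, eq_comm (a := a)]

@[simp] theorem occ_append {i : ℕ} {v w : List A} :
    Occ u i (v ++ w) ↔ Occ u i v ∧ Occ u (i + v.length) w := by
  induction v generalizing i with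
  | nil => simp
  | cons a v ih => simp [ih, and_assoc, Nat.add_comm, Nat.add_left_comm]

@[simp] theorem occ_replicate {i r : ℕ} {a : A} :
    Occ u i (List.replicate r a) ↔ ∀ k < r, u (i + k) = a := by
  induction r generalizing i with
  | zero => simp
  | succ r ih =>
    rw [List.replicate_succ, occ_cons, ih]
    constructor
    · rintro ⟨h0, h⟩ (_ | k) hk
      · exact h0
      · have := h k (by omega)
        rwa [Nat.add_assoc, Nat.add_comm 1 k] at this
    · intro h
      refine ⟨h 0 (by omega), fun k hk => ?_⟩
      have := h (k + 1) (by omega)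
      rwa [Nat.add_assoc, Nat.add_comm 1 k]

theorem Occ.eq_of_length {i : ℕ} {v w : List A} (hv : Occ u i v) (hw : Occ u i w)
    (h : v.length = w.length) : v = w := by
  rw [hv, hw, h]

theorem exists_occ (u : ℕ → A) (i n : ℕ) : ∃ w, Occ u i w ∧ w.length = n :=
  ⟨(List.range n).map (fun j => u (i + j)), by simp [Occ], by simp⟩

theorem mem_language_of_append {x w y : List A} (h : x ++ w ++ y ∈ language u) :
    w ∈ language u := by
  obtain ⟨i, hi⟩ := h
  change Occ u i _ at hi
  simp only [occ_append] at hi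
  exact ⟨_, hi.1.2⟩

theorem mem_language_of_infix {v w : List A} (hvw : v <:+: w) (h : w ∈ language u) :
    v ∈ language u := by
  obtain ⟨x, y, rfl⟩ := hvw
  exact mem_language_of_append h

theorem exists_append_mem_language {w : List A} (h : w ∈ language u) :
    ∃ b, w ++ [b] ∈ language u := by
  obtain ⟨i, hi⟩ := h
  exact ⟨u (i + w.length), i, (occ_append (u := u)).2 ⟨hi, by simp⟩⟩

theorem exists_cons_mem_language (hrev : ∀ w ∈ language u, w.reverse ∈ language u)
    {w : List A} (h : w ∈ language u) : ∃ a, a :: w ∈ language u := by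
  obtain ⟨b, hb⟩ := exists_append_mem_language (hrev w h)
  exact ⟨b, by simpa using hrev _ hb⟩

theorem nil_mem_language (u : ℕ → A) : [] ∈ language u := ⟨0, rfl⟩

end Occurrences

/-! ### Counting factors and palindromes through two-sided extensions -/

section Counting

open Finset

open scoped Classical in
/-- A finite set `E` of pairs of letters, viewed as the set of two-sided extensions of a word,
is balanced when its bilateral multiplicity `#E - #(left) - #(right) + 1` is the excess of
palindromic extensions (`#{a | (a, a) ∈ E} - 1`) if the word is a palindrome, and is zero
otherwise. The proposition `pal` says whether the word is a palindrome. -/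
def Balanced {A : Type*} [Fintype A] (E : Finset (A × A)) (pal : Prop) : Prop :=
  (#E : ℤ) - #(E.image Prod.fst) - #(E.image Prod.snd) + 1 =
    if pal then (#{a | (a, a) ∈ E} : ℤ) - 1 else 0

section Balanced

variable {A : Type*} [Fintype A] {E : Finset (A × A)} {pal : Prop}

theorem Balanced.image_prodMap [DecidableEq A] {f : A → A} (hf : f.Bijective)
    (h : Balanced E pal) : Balanced (E.image (Prod.map f f)) pal := by
  obtain rfl : ‹DecidableEq A› = fun a b => Classical.propDecidable (a = b) :=
    Subsingleton.elim _ _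
  classical
  unfold Balanced at *
  have h1 : (E.image (Prod.map f f)).image Prod.fst = (E.image Prod.fst).image f := by
    simp only [image_image]; rfl
  have h2 : (E.image (Prod.map f f)).image Prod.snd = (E.image Prod.snd).image f := by
    simp only [image_image]; rfl
  have h3 : ({a | (a, a) ∈ E.image (Prod.map f f)} : Finset A) =
      ({a | (a, a) ∈ E} : Finset A).image f := by
    ext a
    obtain ⟨b, rfl⟩ := hf.2 a
    simp [hf.1.eq_iff]
  rw [h1, h2, h3, card_image_of_injective _ hf.1, card_image_of_injective _ hf.1,
    card_image_of_injective _ hf.1, card_image_of_injective _ (hf.1.prodMap hf.1)]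
  exact h

/-- A symmetric nonempty set of pairs with at most one second component is a single pair
`(c, c)`. -/
theorem eq_singleton_of_symm {A : Type*} {E : Finset (A × A)} (hne : E.Nonempty)
    (hsymm : ∀ a b, (a, b) ∈ E → (b, a) ∈ E)
    (hs : ∀ p ∈ E, ∀ q ∈ E, p.2 = q.2) : ∃ c, E = {(c, c)} := by
  obtain ⟨⟨a, b⟩, hab⟩ := hne
  have h1 : a = b := (hs _ hab _ (hsymm _ _ hab)).symm
  subst h1
  refine ⟨a, eq_singleton_iff_unique_mem.2 ⟨hab, ?_⟩⟩
  rintro ⟨c, d⟩ hcd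
  have h1 := hs _ hcd _ hab
  have h2 := hs _ (hsymm _ _ hcd) _ hab
  simp only at h1 h2
  rw [h1, h2]

open scoped Classical in
theorem Balanced.singleton (c : A) : Balanced {(c, c)} pal := by
  have h : ({a | (a, a) ∈ ({(c, c)} : Finset (A × A))} : Finset A) = {c} := by
    ext
    simp
  unfold Balanced
  rw [h]
  simp

open scoped Classical in
/-- A word that is not right special is balanced, provided that its extensions are symmetric if it
is a palindrome. -/
theorem balanced_of_subsingleton_snd (hne : E.Nonempty)
    (hsymm : pal → ∀ a b, (a, b) ∈ E → (b, a) ∈ E)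
    (hs : ∀ p ∈ E, ∀ q ∈ E, p.2 = q.2) : Balanced E pal := by
  by_cases hp : pal
  · obtain ⟨c, rfl⟩ := eq_singleton_of_symm hne (hsymm hp) hs
    exact Balanced.singleton c
  · have h1 : #(E.image Prod.fst) = #E :=
      card_image_of_injOn fun p hp q hq h => Prod.ext h (hs p hp q hq)
    have h2 : #(E.image Prod.snd) = 1 := by
      obtain ⟨p, hpE⟩ := hne
      rw [card_eq_one]
      refine ⟨p.2, eq_singleton_iff_unique_mem.2 ⟨mem_image_of_mem _ hpE, ?_⟩⟩
      simp only [mem_image]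
      rintro _ ⟨q, hq, rfl⟩
      exact hs _ hq _ hpE
    simp [Balanced, h1, h2, hp]

open scoped Classical in
/-- A word that is not left special is balanced, provided that its extensions are symmetric if it
is a palindrome. -/
theorem balanced_of_subsingleton_fst (hne : E.Nonempty)
    (hsymm : pal → ∀ a b, (a, b) ∈ E → (b, a) ∈ E)
    (hs : ∀ p ∈ E, ∀ q ∈ E, p.1 = q.1) : Balanced E pal := by
  have h := balanced_of_subsingleton_snd (E := E.image Prod.swap) (pal := pal) (hne.image _)
    (by
      intro hp a b hab
      simp only [mem_image, Prod.exists, Prod.swap_prod_mk, Prod.mk.injEq] at hab ⊢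
      obtain ⟨c, d, hcd, rfl, rfl⟩ := hab
      exact ⟨d, c, hsymm hp _ _ hcd, rfl, rfl⟩)
    (by
      intro p hp q hq
      simp only [mem_image] at hp hq
      obtain ⟨p', hp', rfl⟩ := hp
      obtain ⟨q', hq', rfl⟩ := hq
      exact hs p' hp' q' hq')
  unfold Balanced at *
  rw [card_image_of_injective _ Prod.swap_injective, image_image, image_image] at h
  have h3 : ∀ a, (a, a) ∈ E.image Prod.swap ↔ (a, a) ∈ E := by
    intro a
    simp only [mem_image, Prod.exists, Prod.swap_prod_mk, Prod.mk.injEq]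
    constructor
    · rintro ⟨c, d, hcd, rfl, rfl⟩
      exact hcd
    · exact fun h => ⟨a, a, h, rfl, rfl⟩
  simp only [h3] at h
  have h4 : (Prod.fst ∘ Prod.swap : A × A → A) = Prod.snd := rfl
  have h5 : (Prod.snd ∘ Prod.swap : A × A → A) = Prod.fst := rfl
  rw [h4, h5] at h
  linarith

end Balanced

variable {A : Type*} [Fintype A] {u : ℕ → A}

/-- The finite set of factors of length `n`. -/
noncomputable def factors (u : ℕ → A) (n : ℕ) : Finset (List A) :=
  ((List.finite_length_eq A n).subset
    (fun _ h => h.2 : {w : List A | w ∈ language u ∧ w.length = n} ⊆ _)).toFinset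

@[simp] theorem mem_factors {n : ℕ} {w : List A} :
    w ∈ factors u n ↔ w ∈ language u ∧ w.length = n := by
  simp [factors]

open scoped Classical in
/-- The two-sided extensions of `w`: the pairs `(a, b)` such that `awb` is a factor. -/
noncomputable def ext (u : ℕ → A) (w : List A) : Finset (A × A) :=
  {p | p.1 :: (w ++ [p.2]) ∈ language u}

@[simp] theorem mem_ext {w : List A} {p : A × A} :
    p ∈ ext u w ↔ p.1 :: (w ++ [p.2]) ∈ language u := by
  simp [ext]

theorem factorComplexity_eq (n : ℕ) : factorComplexity u n = #(factors u n) := by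
  unfold factorComplexity
  rw [← Set.ncard_coe_finset]
  congr 1
  ext w
  simp

open scoped Classical in
theorem palindromicComplexity_eq (n : ℕ) :
    palindromicComplexity u n = #{w ∈ factors u n | w.reverse = w} := by
  unfold palindromicComplexity
  rw [← Set.ncard_coe_finset]
  congr 1
  ext w
  simp [palindromes]
  tauto

theorem ext_nonempty (hrev : ∀ w ∈ language u, w.reverse ∈ language u) {w : List A}
    (hw : w ∈ language u) : (ext u w).Nonempty := by
  obtain ⟨b, hb⟩ := exists_append_mem_language hw
  obtain ⟨a, ha⟩ := exists_cons_mem_language hrev hb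
  exact ⟨(a, b), by simpa using ha⟩

theorem mem_ext_reverse (hrev : ∀ w ∈ language u, w.reverse ∈ language u) {w : List A}
    {a b : A} (h : (a, b) ∈ ext u w) : (b, a) ∈ ext u w.reverse := by
  rw [mem_ext] at h ⊢
  simpa using hrev _ h

open scoped Classical in
theorem card_factors_add_two (n : ℕ) :
    #(factors u (n + 2)) = ∑ w ∈ factors u n, #(ext u w) := by
  rw [card_eq_sum_card_fiberwise (f := fun x : List A => x.tail.dropLast) (t := factors u n)]
  · refine sum_congr rfl fun w hw => ?_
    symm
    refine card_bij (fun p _ => p.1 :: (w ++ [p.2])) ?_ ?_ ?_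
    · intro p hp
      simp only [mem_factors] at hw
      simp only [mem_ext] at hp
      simp [hp, hw.2]
    · rintro ⟨a, b⟩ _ ⟨c, d⟩ _ h
      simpa using h
    · intro x hx
      simp only [mem_filter, mem_factors] at hx
      obtain ⟨⟨hx, hl⟩, rfl⟩ := hx
      obtain ⟨a, y, rfl⟩ : ∃ a y, x = a :: y := List.exists_cons_of_length_eq_add_one hl
      have hy : y ≠ [] := by rintro rfl; simp at hl
      refine ⟨(a, y.getLast hy), ?_, ?_⟩ <;> simp [hx, List.dropLast_append_getLast]
  · intro x hx
    simp only [mem_coe, mem_factors] at hx ⊢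
    refine ⟨mem_language_of_infix ?_ hx.1, by simp [hx.2]⟩
    exact (List.dropLast_prefix _).isInfix.trans (List.tail_suffix _).isInfix

open scoped Classical in
theorem card_factors_succ_right (hrev : ∀ w ∈ language u, w.reverse ∈ language u) (n : ℕ) :
    #(factors u (n + 1)) = ∑ w ∈ factors u n, #((ext u w).image Prod.snd) := by
  rw [card_eq_sum_card_fiberwise (f := fun x : List A => x.dropLast) (t := factors u n)]
  · refine sum_congr rfl fun w hw => ?_
    symm
    refine card_bij (fun b _ => w ++ [b]) ?_ ?_ ?_
    · intro b hb
      simp only [mem_factors] at hw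
      simp only [mem_image, mem_ext] at hb
      obtain ⟨p, hp, rfl⟩ := hb
      simp only [mem_filter, mem_factors, List.length_append, hw.2, List.length_singleton,
        List.dropLast_concat, and_true]
      exact mem_language_of_append (x := [p.1]) (y := []) (by simpa using hp)
    · intro a _ b _ h
      simpa using h
    · intro x hx
      simp only [mem_filter, mem_factors] at hx
      obtain ⟨⟨hx, hl⟩, rfl⟩ := hx
      have hy : x ≠ [] := by rintro rfl; simp at hl
      obtain ⟨a, ha⟩ := exists_cons_mem_language hrev hx
      refine ⟨x.getLast hy, ?_, List.dropLast_append_getLast hy⟩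
      simp only [mem_image]
      exact ⟨(a, x.getLast hy), by simpa [List.dropLast_append_getLast] using ha, rfl⟩
  · intro x hx
    simp only [mem_coe, mem_factors] at hx ⊢
    exact ⟨mem_language_of_infix (List.dropLast_prefix _).isInfix hx.1, by simp [hx.2]⟩

open scoped Classical in
theorem card_factors_succ_left (n : ℕ) :
    #(factors u (n + 1)) = ∑ w ∈ factors u n, #((ext u w).image Prod.fst) := by
  rw [card_eq_sum_card_fiberwise (f := fun x : List A => x.tail) (t := factors u n)]
  · refine sum_congr rfl fun w hw => ?_
    symm
    refine card_bij (fun a _ => a :: w) ?_ ?_ ?_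
    · intro b hb
      simp only [mem_factors] at hw
      simp only [mem_image, mem_ext] at hb
      obtain ⟨p, hp, rfl⟩ := hb
      simp only [mem_filter, mem_factors, List.length_cons, hw.2, List.tail_cons, and_true]
      exact mem_language_of_append (x := []) (y := [p.2]) (by simpa using hp)
    · intro a _ b _ h
      simpa using h
    · intro x hx
      simp only [mem_filter, mem_factors] at hx
      obtain ⟨⟨hx, hl⟩, rfl⟩ := hx
      obtain ⟨a, y, rfl⟩ : ∃ a y, x = a :: y := List.exists_cons_of_length_eq_add_one hl
      obtain ⟨b, hb⟩ := exists_append_mem_language hx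
      refine ⟨a, ?_, rfl⟩
      simp only [mem_image]
      exact ⟨(a, b), by simpa using hb, rfl⟩
  · intro x hx
    simp only [mem_coe, mem_factors] at hx ⊢
    exact ⟨mem_language_of_infix (List.tail_suffix _).isInfix hx.1, by simp [hx.2]⟩

open scoped Classical in
theorem card_palindromes_add_two (n : ℕ) :
    #{w ∈ factors u (n + 2) | w.reverse = w} =
      ∑ w ∈ factors u n with w.reverse = w, #{a | (a, a) ∈ ext u w} := by
  rw [card_eq_sum_card_fiberwise (f := fun x : List A => x.tail.dropLast)
    (t := {w ∈ factors u n | w.reverse = w})]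
  · refine sum_congr rfl fun w hw => ?_
    symm
    refine card_bij (fun a _ => a :: (w ++ [a])) ?_ ?_ ?_
    · intro a ha
      simp only [mem_filter, mem_factors] at hw
      simp only [mem_filter, mem_ext] at ha
      simp [ha, hw.1.2, hw.2]
    · rintro a _ c _ h
      simp only [List.cons.injEq] at h
      exact h.1
    · intro x hx
      simp only [mem_filter, mem_factors] at hx
      obtain ⟨⟨⟨hx, hl⟩, hr⟩, rfl⟩ := hx
      obtain ⟨a, y, rfl⟩ : ∃ a y, x = a :: y := List.exists_cons_of_length_eq_add_one hl
      have hy : y ≠ [] := by rintro rfl; simp at hl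
      obtain ⟨z, b, rfl⟩ : ∃ z b, y = z ++ [b] :=
        ⟨_, _, (List.dropLast_append_getLast hy).symm⟩
      have hab : b = a := by
        simp at hr
        exact hr.1
      subst hab
      refine ⟨b, ?_, ?_⟩ <;> simp [hx]
  · intro x hx
    simp only [coe_filter, mem_factors, Set.mem_ofPred_eq] at hx ⊢
    refine ⟨⟨mem_language_of_infix ?_ hx.1.1, by simp [hx.1.2]⟩, ?_⟩
    · exact (List.dropLast_prefix _).isInfix.trans (List.tail_suffix _).isInfix
    · have h : x.tail.dropLast.reverse = x.reverse.tail.dropLast := by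
        rw [← List.tail_reverse, ← List.dropLast_reverse, List.tail_dropLast]
      rw [h, hx.2]

open scoped Classical in
/-- If the language is closed under reversal and every factor is balanced, then the second
difference of the factor complexity equals `P(n+2) - P(n)`, so that the difference of the two sides
of the identity does not depend on `n`; it vanishes at `n = 0`, as words of length at most one are
palindromes. -/
theorem palindromicComplexity_add_of_balanced
    (hrev : ∀ w ∈ language u, w.reverse ∈ language u)
    (hbal : ∀ w ∈ language u, Balanced (ext u w) (w.reverse = w)) (n : ℕ) :
    (palindromicComplexity u (n + 1) : ℤ) + palindromicComplexity u n =
      (factorComplexity u (n + 1) : ℤ) - factorComplexity u n + 2 := by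
  simp only [factorComplexity_eq, palindromicComplexity_eq]
  induction n with
  | zero =>
    have h0 : factors u 0 = {[]} := by
      ext w
      simp only [mem_factors, mem_singleton, List.length_eq_zero_iff]
      exact ⟨fun h => h.2, fun h => ⟨h ▸ nil_mem_language u, h⟩⟩
    have h1 : ({w ∈ factors u (0 + 1) | w.reverse = w} : Finset (List A)) =
        factors u (0 + 1) := by
      refine filter_true_of_mem fun w hw => ?_
      simp only [mem_factors, zero_add, List.length_eq_one_iff] at hw
      obtain ⟨_, a, rfl⟩ := hw
      rfl
    rw [h1, h0]
    simp [filter_singleton]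
    ring
  | succ n ih =>
    have hsum : ∑ w ∈ factors u n, ((#(ext u w) : ℤ) - #((ext u w).image Prod.fst) -
        #((ext u w).image Prod.snd) + 1) =
        ∑ w ∈ factors u n with w.reverse = w, ((#{a | (a, a) ∈ ext u w} : ℤ) - 1) := by
      rw [sum_filter]
      refine sum_congr rfl fun w hw => ?_
      have h := hbal w (mem_factors.1 hw).1
      unfold Balanced at h
      convert h
    simp only [sum_add_distrib, sum_sub_distrib, sum_const, mul_one, nsmul_eq_mul]
      at hsum
    have e2 := card_factors_add_two (u := u) n
    have el := card_factors_succ_left (u := u) n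
    have er := card_factors_succ_right hrev n
    have ep := card_palindromes_add_two (u := u) n
    zify at e2 el er ep
    rw [← e2, ← el, ← er, ← ep] at hsum
    rw [show n + 1 + 1 = n + 2 from rfl]
    linarith

end Counting

/-! ### Fixed points of morphisms -/

section FixedPoint

variable {A : Type*} {σ : A → List A} {u : ℕ → A}

theorem occ_zero_iff {w : List A} : Occ u 0 w ↔ w = pref u w.length := by
  simp [Occ, pref]

@[simp] theorem length_pref (n : ℕ) : (pref u n).length = n := by simp [pref]

theorem occ_pref (u : ℕ → A) (n : ℕ) : Occ u 0 (pref u n) := by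
  rw [occ_zero_iff, length_pref]

theorem eq_pref_of_prefix {l : List A} {n : ℕ} (h : l <+: pref u n) : l = pref u l.length := by
  obtain ⟨y, hy⟩ := h
  have := occ_pref u n
  rw [← hy, occ_append] at this
  exact occ_zero_iff.1 this.1

theorem pref_succ (n : ℕ) : pref u (n + 1) = pref u n ++ [u n] := by
  simp [pref, List.range_succ]

theorem pref_prefix_pref {k n : ℕ} (h : k ≤ n) : pref u k <+: pref u n := by
  induction n, h using Nat.le_induction with
  | base => exact List.prefix_rfl
  | succ n _ ih => exact ih.trans (pref_succ (u := u) n ▸ List.prefix_append _ _)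

@[simp] theorem morphism_nil : morphism σ [] = [] := rfl

@[simp] theorem morphism_cons (a : A) (w : List A) :
    morphism σ (a :: w) = σ a ++ morphism σ w := by simp [morphism]

@[simp] theorem morphism_append (v w : List A) :
    morphism σ (v ++ w) = morphism σ v ++ morphism σ w := by simp [morphism]

theorem morphism_prefix {v w : List A} (h : v <+: w) : morphism σ v <+: morphism σ w := by
  obtain ⟨y, rfl⟩ := h
  rw [morphism_append]
  exact List.prefix_append _ _

theorem length_le_length_morphism (hσ : ∀ a, σ a ≠ []) (w : List A) :
    w.length ≤ (morphism σ w).length := by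
  induction w with
  | nil => simp
  | cons a w ih =>
    have := List.length_pos_iff.2 (hσ a)
    simp only [morphism_cons, List.length_append, List.length_cons]
    omega

/-- The position in the fixed point `u` of `σ` at which the image of its `n`-th letter begins. -/
def cut (σ : A → List A) (u : ℕ → A) (n : ℕ) : ℕ := (morphism σ (pref u n)).length

@[simp] theorem cut_zero : cut σ u 0 = 0 := by simp [cut, pref]

theorem cut_succ (n : ℕ) : cut σ u (n + 1) = cut σ u n + (σ (u n)).length := by
  simp [cut, pref_succ]

theorem occ_image (hu : IsFixedPoint σ u) (n : ℕ) : Occ u (cut σ u n) (σ (u n)) := by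
  have h : Occ u 0 (morphism σ (pref u (n + 1))) := occ_zero_iff.2 (hu (n + 1))
  rw [pref_succ, morphism_append, occ_append] at h
  simpa [cut] using h.2

theorem occ_morphism (hu : IsFixedPoint σ u) {j : ℕ} {v : List A} (hv : Occ u j v) :
    Occ u (cut σ u j) (morphism σ v) ∧
      cut σ u (j + v.length) = cut σ u j + (morphism σ v).length := by
  induction v generalizing j with
  | nil => simp
  | cons a v ih =>
    obtain ⟨rfl, hv'⟩ := occ_cons.1 hv
    obtain ⟨h1, h2⟩ := ih hv'
    rw [cut_succ] at h1 h2
    refine ⟨?_, ?_⟩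
    · rw [morphism_cons, occ_append]
      exact ⟨occ_image hu j, h1⟩
    · rw [List.length_cons, ← Nat.add_assoc, Nat.add_right_comm, h2]
      simp [Nat.add_assoc]

/-- Every position of the fixed point lies in the image of one of its letters. -/
theorem exists_cut_le_lt (hσ : ∀ a, σ a ≠ []) (i : ℕ) :
    ∃ n, cut σ u n ≤ i ∧ i < cut σ u (n + 1) := by
  have hlt : ∀ n, cut σ u n < cut σ u (n + 1) := fun n => by
    have := List.length_pos_iff.2 (hσ (u n))
    rw [cut_succ]
    omega
  induction i with
  | zero => exact ⟨0, by simp, by simpa using hlt 0⟩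
  | succ i ih =>
    obtain ⟨n, h1, h2⟩ := ih
    by_cases h : i + 1 < cut σ u (n + 1)
    · exact ⟨n, by omega, h⟩
    · exact ⟨n + 1, by omega, by have := hlt (n + 1); omega⟩

/-- Words of unbounded length, each a prefix of the next, are the prefixes of an infinite word. -/
theorem exists_pref_eq {x : ℕ → List A} (hx : ∀ n, x n <+: x (n + 1))
    (hlen : ∀ n, n < (x n).length) : ∃ u : ℕ → A, ∀ n, x n = pref u (x n).length := by
  have hmono : ∀ {k n}, k ≤ n → x k <+: x n := fun {k n} h => by
    induction n, h using Nat.le_induction with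
    | base => exact List.prefix_rfl
    | succ n _ ih => exact ih.trans (hx n)
  refine ⟨fun i => (x i)[i]'(hlen i), fun n => ?_⟩
  refine List.ext_getElem (by simp) fun i h1 _ => ?_
  simp only [pref, List.getElem_map, List.getElem_range]
  rcases le_total i n with h | h
  · exact ((hmono h).getElem (hlen i)).symm
  · exact (hmono h).getElem h1

variable {a : A}

theorem iterate_prefix (ha : [a] <+: σ a) (n : ℕ) :
    (morphism σ)^[n] [a] <+: (morphism σ)^[n + 1] [a] := by
  induction n with
  | zero => simpa using ha
  | succ n ih =>
    rw [Function.iterate_succ_apply' _ n, Function.iterate_succ_apply' _ (n + 1)]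
    exact morphism_prefix ih

theorem lt_length_iterate (hσ : ∀ a, σ a ≠ []) (ha : [a] <+: σ a) (ha2 : 2 ≤ (σ a).length)
    (n : ℕ) : n < ((morphism σ)^[n] [a]).length := by
  have hpre : ∀ n, [a] <+: (morphism σ)^[n] [a] := fun n => by
    induction n with
    | zero => exact List.prefix_rfl
    | succ n ih => exact ih.trans (iterate_prefix ha n)
  induction n with
  | zero => simp
  | succ n ih =>
    obtain ⟨r, hr⟩ := hpre n
    rw [Function.iterate_succ_apply', ← hr]
    rw [← hr] at ih
    have := length_le_length_morphism hσ r
    simp only [List.singleton_append, morphism_cons, List.length_append, List.length_cons] at ih ⊢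
    omega

/-- A nonerasing morphism prolongable on `a` has a fixed point. -/
theorem exists_isFixedPoint (hσ : ∀ a, σ a ≠ []) (ha : [a] <+: σ a)
    (ha2 : 2 ≤ (σ a).length) : ∃ u, IsFixedPoint σ u := by
  obtain ⟨u, hu⟩ := exists_pref_eq (iterate_prefix ha) (lt_length_iterate hσ ha ha2)
  refine ⟨u, fun n => ?_⟩
  have h : pref u n <+: (morphism σ)^[n] [a] := by
    rw [hu n]
    exact pref_prefix_pref (lt_length_iterate hσ ha ha2 n).le
  have h2 := morphism_prefix (σ := σ) h
  rw [← Function.iterate_succ_apply' (morphism σ) n, hu (n + 1)] at h2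
  exact eq_pref_of_prefix h2

theorem iterate_eq_pref (hu : IsFixedPoint σ u) (h0 : u 0 = a) (n : ℕ) :
    (morphism σ)^[n] [a] = pref u ((morphism σ)^[n] [a]).length := by
  induction n with
  | zero => simp [pref, h0]
  | succ n ih =>
    rw [Function.iterate_succ_apply', ih]
    exact hu _

theorem IsFixedPoint.unique (hσ : ∀ a, σ a ≠ []) (ha : [a] <+: σ a)
    (ha2 : 2 ≤ (σ a).length) {v : ℕ → A} (hu : IsFixedPoint σ u) (hu0 : u 0 = a)
    (hv : IsFixedPoint σ v) (hv0 : v 0 = a) : u = v := by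
  funext i
  have h := (iterate_eq_pref hu hu0 i).symm.trans (iterate_eq_pref hv hv0 i)
  have h' := congrArg (fun l : List A => l[i]?) h
  simpa [pref, lt_length_iterate hσ ha ha2 i] using h'

end FixedPoint

/-! ### The morphism `k ↦ 0^t (k+1)`, `m-1 ↦ 0^s` -/

section Phi

variable {m t s : ℕ} [NeZero m]

theorem add_one_eq_zero_iff (k : Fin m) : k + 1 = 0 ↔ ¬ (k : ℕ) + 1 < m := by
  have hk := k.isLt
  rw [Fin.ext_iff, Fin.val_add, Fin.val_zero, Fin.val_one', Nat.add_mod_mod]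
  constructor
  · intro h h1
    rw [Nat.mod_eq_of_lt h1] at h
    omega
  · intro h
    rw [show (k : ℕ) + 1 = m by omega, Nat.mod_self]

theorem phi_of_eq {k : Fin m} (hk : k + 1 = 0) : phi m t s k = List.replicate s 0 := by
  rw [phi, dif_neg ((add_one_eq_zero_iff k).1 hk)]

theorem phi_of_ne {k : Fin m} (hk : k + 1 ≠ 0) :
    phi m t s k = List.replicate t 0 ++ [k + 1] := by
  have h : (k : ℕ) + 1 < m := not_not.1 fun h => hk ((add_one_eq_zero_iff k).2 h)
  rw [phi, dif_pos h]
  congr 2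
  rw [Fin.ext_iff, Fin.val_add, Fin.val_one', Nat.add_mod_mod, Nat.mod_eq_of_lt h]

theorem phi_ne_nil (hs : 1 ≤ s) (k : Fin m) : phi m t s k ≠ [] := by
  by_cases hk : k + 1 = 0
  · rw [phi_of_eq hk, ← List.length_pos_iff, List.length_replicate]
    exact hs
  · rw [phi_of_ne hk]
    simp

theorem singleton_zero_prefix_phi (hs : 1 ≤ s) (hst : s ≤ t) (k : Fin m) :
    [0] <+: phi m t s k := by
  obtain ⟨s', rfl⟩ : ∃ s', s = s' + 1 := ⟨s - 1, by omega⟩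
  obtain ⟨t', rfl⟩ : ∃ t', t = t' + 1 := ⟨t - 1, by omega⟩
  by_cases hk : k + 1 = 0
  · rw [phi_of_eq hk]
    simp [List.replicate_succ]
  · rw [phi_of_ne hk]
    simp [List.replicate_succ]

theorem IsFixedPoint.apply_zero (hs : 1 ≤ s) (hst : s ≤ t) {u : ℕ → Fin m}
    (hu : IsFixedPoint (phi m t s) u) : u 0 = 0 := by
  have h := occ_image hu 0
  obtain ⟨y, hy⟩ := singleton_zero_prefix_phi hs hst (u 0)
  rw [← hy, cut_zero, List.singleton_append, occ_cons] at h
  exact h.1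

/-- The map `v ↦ φ(v) 0^t` commutes with reversal. -/
theorem reverse_morphism_phi (v : List (Fin m)) :
    (morphism (phi m t s) v ++ List.replicate t 0).reverse =
      morphism (phi m t s) v.reverse ++ List.replicate t 0 := by
  induction v with
  | nil => simp
  | cons c v ih =>
    have hc : List.replicate t 0 ++ (phi m t s c).reverse = phi m t s c ++ List.replicate t 0 := by
      by_cases hc : c + 1 = 0
      · rw [phi_of_eq hc]
        simp [Nat.add_comm]
      · rw [phi_of_ne hc]
        simp
    rw [morphism_cons, List.append_assoc, List.reverse_append, ih, List.append_assoc, hc]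
    simp

/-- The word `φ(v) 0^t` begins with `0^t`. -/
theorem exists_morphism_phi_eq (v : List (Fin m)) : ∃ y,
    morphism (phi m t s) v ++ List.replicate t 0 = List.replicate t 0 ++ y := by
  have h := reverse_morphism_phi (m := m) (t := t) (s := s) v.reverse
  rw [List.reverse_append, List.reverse_replicate, List.reverse_reverse] at h
  exact ⟨_, h.symm⟩

end Phi

/-! ### Structure of the fixed point over at least two letters -/

/-- The word `u` is a fixed point of `φ(k) = 0^t (k+1)`, `φ(m-1) = 0^s`, where `t ≥ s ≥ 1` and the
alphabet has at least two letters. Letters are added modulo `m`, so that `m-1` is the letter `k`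
with `k + 1 = 0`. -/
structure IsParryWord (m t s : ℕ) [NeZero m] (u : ℕ → Fin m) : Prop where
  one_le : 1 ≤ s
  le : s ≤ t
  one_ne_zero : (1 : Fin m) ≠ 0
  isFixedPoint : IsFixedPoint (phi m t s) u

theorem occ_replicate_iff {A : Type*} {u : ℕ → A} {i r : ℕ} {a : A} :
    Occ u i (List.replicate r a) ↔ ∀ j, i ≤ j → j < i + r → u j = a := by
  rw [occ_replicate]
  constructor
  · intro h j h1 h2
    have := h (j - i) (by omega)
    rwa [Nat.add_sub_cancel' h1] at this
  · exact fun h k hk => h _ (by omega) (by omega)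

theorem cut_succ_of_ne {m t s : ℕ} [NeZero m] {u : ℕ → Fin m} {n : ℕ} (hn : u n + 1 ≠ 0) :
    cut (phi m t s) u (n + 1) = cut (phi m t s) u n + t + 1 := by
  rw [cut_succ, phi_of_ne hn]
  simp [Nat.add_assoc]

theorem cut_succ_of_eq {m t s : ℕ} [NeZero m] {u : ℕ → Fin m} {n : ℕ} (hn : u n + 1 = 0) :
    cut (phi m t s) u (n + 1) = cut (phi m t s) u n + s := by
  rw [cut_succ, phi_of_eq hn, List.length_replicate]

namespace IsParryWord

variable {m t s : ℕ} [NeZero m] {u : ℕ → Fin m} (h : IsParryWord m t s u)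
include h

theorem apply_of_ne {n : ℕ} (hn : u n + 1 ≠ 0) :
    (∀ j, cut (phi m t s) u n ≤ j → j < cut (phi m t s) u n + t → u j = 0) ∧
      u (cut (phi m t s) u n + t) = u n + 1 := by
  have ho := occ_image h.isFixedPoint n
  rw [phi_of_ne hn, occ_append, occ_replicate_iff] at ho
  simpa using ho

theorem apply_of_eq {n : ℕ} (hn : u n + 1 = 0) :
    ∀ j, cut (phi m t s) u n ≤ j → j < cut (phi m t s) u n + s → u j = 0 := by
  have ho := occ_image h.isFixedPoint n
  rwa [phi_of_eq hn, occ_replicate_iff] at ho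

theorem exists_cut_of_ne_zero {i : ℕ} (hi : u i ≠ 0) :
    ∃ n, i = cut (phi m t s) u n + t ∧ u n + 1 = u i := by
  obtain ⟨n, h1, h2⟩ := exists_cut_le_lt (u := u) (phi_ne_nil (t := t) h.one_le) i
  by_cases hn : u n + 1 = 0
  · rw [cut_succ_of_eq hn] at h2
    exact absurd (h.apply_of_eq hn i h1 h2) hi
  · rw [cut_succ_of_ne hn] at h2
    obtain ⟨h3, h4⟩ := h.apply_of_ne hn
    have : i = cut (phi m t s) u n + t := by
      by_contra hne
      exact hi (h3 i h1 (by omega))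
    exact ⟨n, this, by rw [this, h4]⟩

theorem eq_zero_or_eq_zero (n : ℕ) : u n = 0 ∨ u (n + 1) = 0 := by
  by_contra! hne
  obtain ⟨k, h1, h2⟩ := h.exists_cut_of_ne_zero hne.2
  have hne' : u k + 1 ≠ 0 := h2 ▸ hne.2
  have := h.one_le
  have := h.le
  exact hne.1 ((h.apply_of_ne hne').1 n (by omega) (by omega))

theorem ne_zero_of_add_one_eq_zero {k : Fin m} (hk : k + 1 = 0) : k ≠ 0 := by
  rintro rfl
  rw [zero_add] at hk
  exact h.one_ne_zero hk

/-- From any cut, the word continues with `0^t` and then with the successor of the letter whose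
image begins there, even if this image is `0^s`. -/
theorem apply_cut_add (n : ℕ) :
    (∀ j, cut (phi m t s) u n ≤ j → j < cut (phi m t s) u n + t → u j = 0) ∧
      u (cut (phi m t s) u n + t) = u n + 1 := by
  by_cases hn : u n + 1 = 0
  · have h1 := h.apply_of_eq hn
    have hn1 : u (n + 1) = 0 :=
      (h.eq_zero_or_eq_zero n).resolve_left (h.ne_zero_of_add_one_eq_zero hn)
    have h2 := (h.apply_of_ne (n := n + 1) (by rw [hn1, zero_add]; exact h.one_ne_zero)).1
    rw [cut_succ_of_eq hn] at h2
    have h3 : ∀ j, cut (phi m t s) u n ≤ j → j < cut (phi m t s) u n + s + t → u j = 0 := by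
      intro j hj hj'
      by_cases hjs : j < cut (phi m t s) u n + s
      · exact h1 j hj hjs
      · exact h2 j (by omega) hj'
    have := h.one_le
    exact ⟨fun j hj hj' => h3 j hj (by omega), by rw [h3 _ (by omega) (by omega), hn]⟩
  · exact h.apply_of_ne hn

/-- The image of a letter ends with the successor of this letter. -/
theorem apply_of_add_one_eq_cut {i n : ℕ} (hi : i + 1 = cut (phi m t s) u (n + 1)) :
    u i = u n + 1 := by
  have := h.one_le
  by_cases hn : u n + 1 = 0
  · rw [cut_succ_of_eq hn] at hi
    rw [h.apply_of_eq hn i (by omega) (by omega), hn]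
  · rw [cut_succ_of_ne hn] at hi
    rw [← (h.apply_of_ne hn).2]
    congr 1
    omega

theorem exists_apply_eq (k : Fin m) : ∃ n, u n = k := by
  obtain ⟨k, hk⟩ := k
  induction k with
  | zero => exact ⟨0, h.isFixedPoint.apply_zero h.one_le h.le⟩
  | succ k ih =>
    obtain ⟨n, hn⟩ := ih (by omega)
    refine ⟨_, (h.apply_cut_add n).2.trans ?_⟩
    rw [hn, Fin.ext_iff, Fin.val_add, Fin.val_one', Nat.add_mod_mod, Nat.mod_eq_of_lt hk]

/-! ### Closure under reversal -/

/-- If `v` is followed by `b`, then `φ(v)` is followed by `0^t (b+1)`, also when `b + 1 = 0`. -/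
theorem occ_morphism_append {j : ℕ} {v : List (Fin m)} {b : Fin m} (hv : Occ u j (v ++ [b])) :
    Occ u (cut (phi m t s) u j)
      (morphism (phi m t s) v ++ (List.replicate t 0 ++ [b + 1])) := by
  rw [occ_append] at hv
  obtain ⟨hv, hb⟩ := hv
  obtain ⟨h1, h2⟩ := occ_morphism h.isFixedPoint hv
  obtain ⟨h3, h4⟩ := h.apply_cut_add (j + v.length)
  rw [h2] at h3 h4
  rw [occ_append, occ_append, occ_replicate_iff]
  refine ⟨h1, h3, ?_⟩
  simp only [occ_cons, occ_nil, and_true] at hb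
  simp [h4, hb]

theorem morphism_append_mem_language {v : List (Fin m)} (hv : v ∈ language u) :
    morphism (phi m t s) v ++ List.replicate t 0 ∈ language u := by
  obtain ⟨b, j, hj⟩ := exists_append_mem_language hv
  refine mem_language_of_append (x := []) (y := [b + 1])
    (mem_language_iff.2 ⟨cut (phi m t s) u j, ?_⟩)
  simpa [-occ_append] using h.occ_morphism_append hj

omit h in
theorem two_le_length_phi_zero (h1 : (1 : Fin m) ≠ 0) (ht : 1 ≤ t) :
    2 ≤ (phi m t s 0).length := by
  rw [phi_of_ne (by rwa [zero_add])]
  simpa using ht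

/-- The words obtained from `0` by iterating `v ↦ φ(v) 0^t` are palindromic factors having the
iterates `φⁿ(0)`, hence arbitrarily long prefixes of `u`, as prefixes. So every factor lies in a
palindromic factor. -/
theorem reverse_mem_language (w : List (Fin m)) (hw : w ∈ language u) :
    w.reverse ∈ language u := by
  have h0 := h.isFixedPoint.apply_zero h.one_le h.le
  have hpal : ∀ n, ∃ x ∈ language u, x.reverse = x ∧ (morphism (phi m t s))^[n] [0] <+: x := by
    intro n
    induction n with
    | zero => exact ⟨[0], ⟨0, by simp [h0]⟩, rfl, List.prefix_rfl⟩
    | succ n ih =>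
      obtain ⟨x, hx, hr, hp⟩ := ih
      refine ⟨_, h.morphism_append_mem_language hx, by rw [reverse_morphism_phi, hr], ?_⟩
      rw [Function.iterate_succ_apply']
      exact (morphism_prefix hp).trans (List.prefix_append _ _)
  obtain ⟨i, hi⟩ := mem_language_iff.1 hw
  obtain ⟨x, hx, hr, hp⟩ := hpal (i + w.length)
  rw [iterate_eq_pref h.isFixedPoint h0] at hp
  have hlt := lt_length_iterate (phi_ne_nil (m := m) (t := t) h.one_le)
    (singleton_zero_prefix_phi h.one_le h.le 0)
    (two_le_length_phi_zero h.one_ne_zero (h.one_le.trans h.le)) (i + w.length)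
  have hwx : w <:+: x := by
    refine List.IsInfix.trans ?_ ((pref_prefix_pref hlt.le).trans hp).isInfix
    have ho : Occ u 0 (pref u i ++ w) := by
      rw [occ_append]
      exact ⟨occ_pref u i, by rwa [length_pref, Nat.zero_add]⟩
    rw [occ_zero_iff, List.length_append, length_pref] at ho
    rw [← ho]
    exact (List.suffix_append _ _).isInfix
  refine mem_language_of_infix ?_ hx
  rw [← hr]
  exact List.reverse_infix.2 hwx

/-! ### Runs of zeros -/

/-- A run of zeros before a nonzero letter `b` has length at most `t`, or at most `t + s` if
`b = 1`. -/
theorem le_of_zeros {i e : ℕ} (hz : ∀ j, i ≤ j → j < e → u j = 0) (he : u e ≠ 0) :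
    e ≤ i + t ∨ e ≤ i + t + s ∧ u e = 1 := by
  obtain ⟨n, hn, hne⟩ := h.exists_cut_of_ne_zero he
  by_cases hle : e ≤ i + t
  · exact Or.inl hle
  refine Or.inr ?_
  obtain _ | n := n
  · rw [cut_zero] at hn
    omega
  -- The run goes back beyond the cut `n + 1`, so the image that ends there is `0^s`.
  obtain ⟨c, hc⟩ : ∃ c, c + 1 = cut (phi m t s) u (n + 1) :=
    ⟨cut (phi m t s) u (n + 1) - 1, by omega⟩
  have h1 : u n + 1 = 0 := by
    rw [← h.apply_of_add_one_eq_cut hc]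
    exact hz c (by omega) (by omega)
  have h2 := (h.eq_zero_or_eq_zero n).resolve_left (h.ne_zero_of_add_one_eq_zero h1)
  refine ⟨?_, by rw [← hne, h2, zero_add]⟩
  rw [cut_succ_of_eq h1] at hn
  -- A longer run would contain two consecutive images `0^s`, but the letter `m - 1` is isolated.
  by_contra hgt
  obtain _ | k := n
  · rw [cut_zero] at hn
    omega
  obtain ⟨d, hd⟩ : ∃ d, d + 1 = cut (phi m t s) u (k + 1) :=
    ⟨cut (phi m t s) u (k + 1) - 1, by omega⟩
  have h3 : u k + 1 = 0 := by
    rw [← h.apply_of_add_one_eq_cut hd]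
    exact hz d (by omega) (by omega)
  exact (h.eq_zero_or_eq_zero k).elim (h.ne_zero_of_add_one_eq_zero h3)
    (h.ne_zero_of_add_one_eq_zero h1)

/-- The maximal runs of zeros between nonzero letters `a` and `b` have length `t`, and then `a` or
`b` is `1`, or length `t + s`, and then `a = b = 1`. -/
theorem eq_of_zeros {i e : ℕ} (hie : i < e) (hi : u i ≠ 0)
    (hz : ∀ j, i < j → j < e → u j = 0) (he : u e ≠ 0) :
    (e = i + 1 + t ∧ (u i = 1 ∨ u e = 1)) ∨ (e = i + 1 + t + s ∧ u i = 1 ∧ u e = 1) := by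
  obtain ⟨n, hn, hne⟩ := h.exists_cut_of_ne_zero he
  have hic : i < cut (phi m t s) u n := by
    by_contra hci
    exact hi ((h.apply_cut_add n).1 i (by omega) (by omega))
  obtain _ | n := n
  · rw [cut_zero] at hic
    omega
  obtain ⟨c, hc⟩ : ∃ c, c + 1 = cut (phi m t s) u (n + 1) :=
    ⟨cut (phi m t s) u (n + 1) - 1, by omega⟩
  have h1 := h.apply_of_add_one_eq_cut hc
  by_cases hci : c = i
  · left
    subst hci
    refine ⟨by omega, ?_⟩
    rw [h1, ← hne]
    exact (h.eq_zero_or_eq_zero n).imp (fun h0 => by rw [h0, zero_add])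
      (fun h0 => by rw [h0, zero_add])
  · right
    have h2 : u n + 1 = 0 := by
      rw [← h1]
      exact hz c (by omega) (by omega)
    have hn0 := h.ne_zero_of_add_one_eq_zero h2
    have h3 := (h.eq_zero_or_eq_zero n).resolve_left hn0
    rw [cut_succ_of_eq h2] at hn hic
    have hic' : i < cut (phi m t s) u n := by
      by_contra hci
      exact hi (h.apply_of_eq h2 i (by omega) hic)
    obtain _ | k := n
    · rw [cut_zero] at hic'
      omega
    obtain ⟨d, hd⟩ : ∃ d, d + 1 = cut (phi m t s) u (k + 1) :=
      ⟨cut (phi m t s) u (k + 1) - 1, by omega⟩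
    have h4 : u d = 1 := by
      rw [h.apply_of_add_one_eq_cut hd, (h.eq_zero_or_eq_zero k).resolve_right hn0, zero_add]
    have hdi : d = i := by
      by_contra hdi
      exact h.one_ne_zero (h4 ▸ hz d (by omega) (by omega))
    subst hdi
    exact ⟨by omega, h4, by rw [← hne, h3, zero_add]⟩

theorem exists_ne_zero (i : ℕ) : ∃ e, i ≤ e ∧ u e ≠ 0 := by
  have hle : ∀ n, n ≤ cut (phi m t s) u n := fun n => by
    have := length_le_length_morphism (phi_ne_nil (t := t) h.one_le) (pref u n)
    rwa [length_pref] at this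
  by_cases hi : u i + 1 = 0
  · refine ⟨cut (phi m t s) u (i + 1) + t, by have := hle (i + 1); omega, ?_⟩
    rw [(h.apply_cut_add _).2,
      (h.eq_zero_or_eq_zero i).resolve_left (h.ne_zero_of_add_one_eq_zero hi), zero_add]
    exact h.one_ne_zero
  · exact ⟨cut (phi m t s) u i + t, by have := hle i; omega, by rwa [(h.apply_cut_add _).2]⟩

/-- No run of zeros, wherever it ends, is longer than `t + s`. -/
theorem le_of_zeros_all {i e : ℕ} (hz : ∀ j, i ≤ j → j < e → u j = 0) : e ≤ i + t + s := by
  have hex := h.exists_ne_zero i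
  obtain ⟨h1, h2⟩ := Nat.find_spec hex
  have hmin : ∀ j, i ≤ j → j < Nat.find hex → u j = 0 := fun j hj hlt => by
    by_contra hne
    exact Nat.find_min hex hlt ⟨hj, hne⟩
  have he : e ≤ Nat.find hex := by
    by_contra hlt
    exact h2 (hz _ h1 (by omega))
  have := h.le_of_zeros hmin h2
  omega

omit h in
theorem mem_ext_replicate_iff {r : ℕ} {a b : Fin m} :
    (a, b) ∈ ext u (List.replicate r 0) ↔
      ∃ i, u i = a ∧ (∀ j, i < j → j < i + 1 + r → u j = 0) ∧ u (i + 1 + r) = b := by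
  rw [mem_ext, mem_language_iff]
  simp [-occ_replicate, occ_replicate_iff]

theorem mem_ext_replicate_swap {r : ℕ} {a b : Fin m}
    (hab : (a, b) ∈ ext u (List.replicate r 0)) : (b, a) ∈ ext u (List.replicate r 0) := by
  simpa using mem_ext_reverse h.reverse_mem_language hab

/-- `0` may precede any letter; the empty word is written as `0^0`. -/
theorem zero_mem_ext_nil (b : Fin m) : (0, b) ∈ ext u (List.replicate 0 0) := by
  rw [mem_ext_replicate_iff]
  have hs := h.one_le
  have ht := h.one_le.trans h.le
  by_cases hb : b = 0
  · subst hb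
    -- The image `0^s` of the letter `m - 1` is followed by an image that begins with `0`.
    obtain ⟨n, hn⟩ := h.exists_apply_eq (-1)
    have hn' : u n + 1 = 0 := by rw [hn, neg_add_cancel]
    have h1 := (h.apply_cut_add (n + 1)).1
    rw [cut_succ_of_eq hn'] at h1
    exact ⟨cut (phi m t s) u n + s - 1, h.apply_of_eq hn' _ (by omega) (by omega),
      fun j hj hj' => by omega, h1 _ (by omega) (by omega)⟩
  · obtain ⟨n, rfl⟩ := h.exists_apply_eq b
    obtain ⟨k, rfl, -⟩ := h.exists_cut_of_ne_zero hb
    refine ⟨cut (phi m t s) u k + t - 1, (h.apply_cut_add k).1 _ (by omega) (by omega),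
      fun j hj hj' => by omega, ?_⟩
    congr 1
    omega

theorem mem_ext_replicate_t {a b : Fin m} (hab : a = 1 ∨ b = 1) :
    (a, b) ∈ ext u (List.replicate t 0) := by
  -- The run `0^t` and the letter `b` follow the cut at the end of the image of `a - 1`.
  have hmem : (a - 1, b - 1) ∈ ext u (List.replicate 0 0) := by
    rcases hab with rfl | rfl
    · rw [sub_self]
      exact h.zero_mem_ext_nil _
    · rw [sub_self]
      exact h.mem_ext_replicate_swap (h.zero_mem_ext_nil _)
  rw [mem_ext_replicate_iff] at hmem ⊢
  obtain ⟨n, h1, -, h2⟩ := hmem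
  rw [Nat.add_zero] at h2
  have hpos : 0 < cut (phi m t s) u (n + 1) := by
    have := List.length_pos_iff.2 (phi_ne_nil (t := t) h.one_le (u n))
    rw [cut_succ]
    omega
  obtain ⟨c, hc⟩ : ∃ c, c + 1 = cut (phi m t s) u (n + 1) :=
    ⟨cut (phi m t s) u (n + 1) - 1, by omega⟩
  obtain ⟨h3, h4⟩ := h.apply_cut_add (n + 1)
  rw [← hc] at h3 h4
  refine ⟨c, ?_, fun j hj hj' => h3 j (by omega) hj', ?_⟩
  · rw [h.apply_of_add_one_eq_cut hc, h1, sub_add_cancel]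
  · rw [h4, h2, sub_add_cancel]

/-- The letter `m - 1` occurs between two letters `0`, and `φ(0 (m-1) 0) = 0^t 1 0^(s+t) 1`. -/
theorem one_one_mem_ext : (1, 1) ∈ ext u (List.replicate (t + s) 0) := by
  rw [mem_ext_replicate_iff]
  obtain ⟨n, hn⟩ := h.exists_apply_eq (-1)
  have hn' : u n + 1 = 0 := by rw [hn, neg_add_cancel]
  have hn0 := h.ne_zero_of_add_one_eq_zero hn'
  obtain _ | n := n
  · exact absurd (h.isFixedPoint.apply_zero h.one_le h.le) hn0
  have h0 := (h.eq_zero_or_eq_zero n).resolve_right hn0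
  have h2 := (h.eq_zero_or_eq_zero (n + 1)).resolve_left hn0
  have hne : u n + 1 ≠ 0 := by
    rw [h0, zero_add]
    exact h.one_ne_zero
  have hc := cut_succ_of_ne (t := t) (s := s) hne
  have h3 := h.apply_of_eq hn'
  obtain ⟨h4, h5⟩ := h.apply_cut_add (n + 1 + 1)
  rw [cut_succ_of_eq hn', hc] at h4 h5
  rw [hc] at h3
  refine ⟨cut (phi m t s) u n + t, ?_, fun j hj hj' => ?_, ?_⟩
  · rw [(h.apply_cut_add n).2, h0, zero_add]
  · by_cases hjs : j < cut (phi m t s) u n + t + 1 + s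
    · exact h3 j (by omega) hjs
    · exact h4 j (by omega) (by omega)
  · rw [show cut (phi m t s) u n + t + 1 + (t + s) = cut (phi m t s) u n + t + 1 + s + t by omega,
      h5, h2, zero_add]

omit h in
theorem zero_mem_ext_of_lt {r R : ℕ} {a b : Fin m} (hr : r < R)
    (hab : (a, b) ∈ ext u (List.replicate R 0)) : (0, b) ∈ ext u (List.replicate r 0) := by
  rw [mem_ext_replicate_iff] at *
  obtain ⟨i, -, h2, h3⟩ := hab
  refine ⟨i + R - r, h2 _ (by omega) (by omega), fun j hj hj' => h2 j (by omega) (by omega), ?_⟩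
  rw [← h3]
  congr 1
  omega

omit h in
theorem zero_zero_mem_ext_of_lt {r R : ℕ} {a b : Fin m} (hr : r + 2 ≤ R)
    (hab : (a, b) ∈ ext u (List.replicate R 0)) : (0, 0) ∈ ext u (List.replicate r 0) := by
  rw [mem_ext_replicate_iff] at *
  obtain ⟨i, -, h2, -⟩ := hab
  exact ⟨i + 1, h2 _ (by omega) (by omega), fun j hj hj' => h2 j (by omega) (by omega),
    h2 _ (by omega) (by omega)⟩

theorem zero_zero_mem_ext_replicate {r : ℕ} :
    ((0, 0) : Fin m × Fin m) ∈ ext u (List.replicate r 0) ↔ r + 2 ≤ t + s := by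
  refine ⟨fun hr => ?_, fun hr => zero_zero_mem_ext_of_lt hr h.one_one_mem_ext⟩
  obtain ⟨i, h1, h2, h3⟩ := mem_ext_replicate_iff.1 hr
  have := h.le_of_zeros_all (i := i) (e := i + r + 2) fun j hj hj' => by
    obtain rfl | hlt := eq_or_lt_of_le hj
    · exact h1
    · obtain hlt' | rfl := lt_or_eq_of_le (show j ≤ i + 1 + r by omega)
      · exact h2 j hlt hlt'
      · exact h3
  omega

theorem zero_mem_ext_replicate {r : ℕ} {b : Fin m} (hb : b ≠ 0) :
    (0, b) ∈ ext u (List.replicate r 0) ↔ r < t ∨ r < t + s ∧ b = 1 := by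
  constructor
  · intro hr
    obtain ⟨i, h1, h2, rfl⟩ := mem_ext_replicate_iff.1 hr
    have := h.le_of_zeros (i := i) (e := i + 1 + r) (fun j hj hj' => by
      obtain rfl | hlt := eq_or_lt_of_le hj
      · exact h1
      · exact h2 j hlt hj') hb
    refine this.imp (fun h => by omega) (fun h => ⟨by omega, h.2⟩)
  · rintro (hr | ⟨hr, rfl⟩)
    · exact zero_mem_ext_of_lt hr (h.mem_ext_replicate_t (a := 1) (Or.inl rfl))
    · exact zero_mem_ext_of_lt hr h.one_one_mem_ext

theorem mem_ext_zero_replicate {r : ℕ} {a : Fin m} (ha : a ≠ 0) :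
    (a, 0) ∈ ext u (List.replicate r 0) ↔ r < t ∨ r < t + s ∧ a = 1 := by
  rw [← h.zero_mem_ext_replicate ha]
  exact ⟨h.mem_ext_replicate_swap, h.mem_ext_replicate_swap⟩

theorem mem_ext_replicate_of_ne {r : ℕ} {a b : Fin m} (ha : a ≠ 0) (hb : b ≠ 0) :
    (a, b) ∈ ext u (List.replicate r 0) ↔
      (r = t ∧ (a = 1 ∨ b = 1)) ∨ (r = t + s ∧ a = 1 ∧ b = 1) := by
  constructor
  · intro hr
    obtain ⟨i, rfl, h2, rfl⟩ := mem_ext_replicate_iff.1 hr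
    have := h.eq_of_zeros (by omega) ha h2 hb
    exact this.imp (fun h => ⟨by omega, h.2⟩) (fun h => ⟨by omega, h.2⟩)
  · rintro (⟨rfl, hab⟩ | ⟨rfl, rfl, rfl⟩)
    · exact h.mem_ext_replicate_t hab
    · exact h.one_one_mem_ext

end IsParryWord

/-! ### Balanced sets of extensions -/

section

open Finset

variable {A : Type*} [Fintype A] {E : Finset (A × A)} {pal : Prop}

/-- Adding a palindromic extension by a letter that already extends the word on both sides raises
the two sides of the equation by one. -/
theorem Balanced.insert_diag [DecidableEq A] {d : A} (hE : Balanced E True) (hd : (d, d) ∉ E)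
    (h1 : d ∈ E.image Prod.fst) (h2 : d ∈ E.image Prod.snd) :
    Balanced (insert (d, d) E) True := by
  obtain rfl : ‹DecidableEq A› = fun a b => Classical.propDecidable (a = b) :=
    Subsingleton.elim _ _
  classical
  have h3 : ({a | (a, a) ∈ insert (d, d) E} : Finset A) =
      insert d ({a | (a, a) ∈ E} : Finset A) := by
    ext a
    simp
  unfold Balanced at *
  rw [h3, image_insert, image_insert, insert_eq_of_mem h1, insert_eq_of_mem h2,
    card_insert_of_notMem hd, card_insert_of_notMem (by simpa using hd)]
  simp only [if_true] at hE ⊢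
  push_cast
  linarith

open scoped Classical in
theorem balanced_cross {c : A} (hE : ∀ a b, (a, b) ∈ E ↔ a = c ∨ b = c) : Balanced E True := by
  have h1 : E.image Prod.fst = univ := by
    ext a
    simpa using ⟨c, (hE a c).2 (Or.inr rfl)⟩
  have h2 : E.image Prod.snd = univ := by
    ext a
    simpa using ⟨c, (hE c a).2 (Or.inl rfl)⟩
  have h3 : ({a | (a, a) ∈ E} : Finset A) = {c} := by
    ext a
    simp [hE]
  have h4 : E = univ.image (fun b => (c, b)) ∪ univ.image (fun a => (a, c)) := by
    ext ⟨a, b⟩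
    simp [hE, eq_comm]
  have h5 : (univ.image (fun b => (c, b)) ∩ univ.image (fun a => (a, c)) : Finset (A × A)) =
      {(c, c)} := by
    ext ⟨a, b⟩
    simp [eq_comm]
  have h6 := card_union_add_card_inter (univ.image (fun b : A => (c, b)))
    (univ.image (fun a => (a, c)))
  rw [← h4, h5, card_image_of_injective _ fun a b h => (Prod.ext_iff.1 h).2,
    card_image_of_injective _ fun a b h => (Prod.ext_iff.1 h).1, card_singleton] at h6
  unfold Balanced
  rw [h1, h2, h3]
  simp only [if_true, card_singleton]
  zify at h6
  push_cast
  linarith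

theorem balanced_pair [DecidableEq A] {c d : A} (hcd : c ≠ d) :
    Balanced {(c, d), (d, c)} True := by
  obtain rfl : ‹DecidableEq A› = fun a b => Classical.propDecidable (a = b) :=
    Subsingleton.elim _ _
  classical
  have h3 : ({a | (a, a) ∈ ({(c, d), (d, c)} : Finset (A × A))} : Finset A) = ∅ := by
    ext a
    simp only [mem_filter, mem_insert, mem_singleton, Prod.mk.injEq, notMem_empty, iff_false]
    rintro ⟨-, ⟨rfl, h⟩ | ⟨rfl, h⟩⟩
    · exact hcd h
    · exact hcd h.symm
  unfold Balanced
  rw [h3, image_insert, image_insert, image_singleton, image_singleton, card_pair,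
    card_pair hcd, card_pair hcd.symm]
  · simp
  · simp [hcd]

end

namespace IsParryWord

variable {m t s : ℕ} [NeZero m] {u : ℕ → Fin m} (h : IsParryWord m t s u)
include h

/-! ### Factors without nonzero letters -/

theorem balanced_replicate {r : ℕ} (hr : List.replicate r (0 : Fin m) ∈ language u) :
    Balanced (ext u (List.replicate r 0)) True := by
  have h1 := h.one_ne_zero
  have hrts : r ≤ t + s := by
    obtain ⟨i, hi⟩ := mem_language_iff.1 hr
    rw [occ_replicate_iff] at hi
    have := h.le_of_zeros_all hi
    omega
  have hs := h.one_le
  have key : ∀ a b : Fin m, (a, b) ∈ ext u (List.replicate r 0) ↔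
      (a = 0 ∧ b = 0 ∧ r + 2 ≤ t + s) ∨
      (a = 0 ∧ b ≠ 0 ∧ (r < t ∨ r < t + s ∧ b = 1)) ∨
      (a ≠ 0 ∧ b = 0 ∧ (r < t ∨ r < t + s ∧ a = 1)) ∨
      (a ≠ 0 ∧ b ≠ 0 ∧ ((r = t ∧ (a = 1 ∨ b = 1)) ∨ (r = t + s ∧ a = 1 ∧ b = 1))) := by
    intro a b
    by_cases ha : a = 0 <;> by_cases hb : b = 0
    · subst ha hb
      simp [h.zero_zero_mem_ext_replicate]
    · subst ha
      simp [h.zero_mem_ext_replicate hb, hb]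
    · subst hb
      simp [h.mem_ext_zero_replicate ha, ha]
    · simp [h.mem_ext_replicate_of_ne ha hb, ha, hb]
  rcases lt_trichotomy r t with hrt | rfl | hrt
  · refine balanced_cross (c := 0) fun a b => ?_
    rw [key]
    have e1 : r + 2 ≤ t + s := by omega
    have e2 : r ≠ t := by omega
    have e3 : r ≠ t + s := by omega
    simp only [e1, e2, e3, hrt]
    tauto
  · have e1 : r < r + s := by omega
    have e2 : r ≠ r + s := by omega
    set E : Finset (Fin m × Fin m) := {p | p.1 = 1 ∨ p.2 = 1} with hE
    have hcross : Balanced E True := balanced_cross (c := 1) fun a b => by simp [hE]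
    by_cases hs2 : r + 2 ≤ r + s
    · have : ext u (List.replicate r 0) = insert (0, 0) E := by
        ext ⟨a, b⟩
        rw [key]
        simp only [hE, hs2, e1, e2, lt_irrefl, Finset.mem_insert, Finset.mem_filter,
          Finset.mem_univ, Prod.mk.injEq]
        by_cases ha : a = 0 <;> by_cases hb : b = 0 <;> simp [ha, hb, h1.symm]
      rw [this]
      refine hcross.insert_diag (by simp [hE, h1.symm]) ?_ ?_
      · exact Finset.mem_image.2 ⟨(0, 1), by simp [hE], rfl⟩
      · exact Finset.mem_image.2 ⟨(1, 0), by simp [hE], rfl⟩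
    · have : ext u (List.replicate r 0) = E := by
        ext ⟨a, b⟩
        rw [key]
        simp only [hE, hs2, e1, e2, lt_irrefl, Finset.mem_filter, Finset.mem_univ]
        by_cases ha : a = 0 <;> by_cases hb : b = 0 <;> simp [ha, hb, h1.symm]
      rw [this]
      exact hcross
  · have e1 : ¬ r < t := by omega
    have e2 : r ≠ t := by omega
    rcases lt_or_eq_of_le hrts with hlt | rfl
    · have e3 : r ≠ t + s := by omega
      have hpair := balanced_pair h1.symm
      by_cases hs2 : r + 2 ≤ t + s
      · have : ext u (List.replicate r 0) = insert (0, 0) {(0, 1), (1, 0)} := by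
          ext ⟨a, b⟩
          rw [key]
          simp only [hs2, e1, e2, e3, hlt, Finset.mem_insert, Finset.mem_singleton, Prod.mk.injEq]
          by_cases ha : a = 0 <;> by_cases hb : b = 0 <;> simp [ha, hb, h1.symm]
        rw [this]
        exact hpair.insert_diag (by simp [h1.symm]) (by simp) (by simp)
      · have : ext u (List.replicate r 0) = {(0, 1), (1, 0)} := by
          ext ⟨a, b⟩
          rw [key]
          simp only [hs2, e1, e2, e3, hlt, Finset.mem_insert, Finset.mem_singleton, Prod.mk.injEq]
          by_cases ha : a = 0 <;> by_cases hb : b = 0 <;> simp [ha, hb, h1.symm]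
        rw [this]
        exact hpair
    · have : ext u (List.replicate (t + s) 0) = {(1, 1)} := by
        ext ⟨a, b⟩
        rw [key]
        have e4 : ¬ t + s + 2 ≤ t + s := by omega
        simp only [e1, e2, e4, lt_irrefl, Finset.mem_singleton, Prod.mk.injEq]
        by_cases ha : a = 0 <;> by_cases hb : b = 0 <;> simp [ha, hb, h1.symm]
      rw [this]
      exact Balanced.singleton 1

/-! ### Bispecial factors with a nonzero letter -/

/-- Synchronization: the letter at distance `t` after a cut determines the letter whose image
begins there, so `φ(v) 0^t b` can begin at a cut only as part of the image of `v (b-1)`. -/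
theorem occ_of_occ_morphism {j : ℕ} {v : List (Fin m)} {b : Fin m}
    (ho : Occ u (cut (phi m t s) u j)
      (morphism (phi m t s) v ++ (List.replicate t 0 ++ [b]))) : Occ u j (v ++ [b - 1]) := by
  induction v generalizing j with
  | nil =>
    simp only [morphism_nil, List.nil_append, occ_append, List.length_replicate, occ_cons,
      (h.apply_cut_add j).2] at ho
    simp [← ho.2.1]
  | cons c v ih =>
    have hst := h.le
    have hs := h.one_le
    have hc : u j = c := by
      refine add_right_cancel (b := 1) ((h.apply_cut_add j).2.symm.trans ?_)
      by_cases hc : c + 1 = 0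
      · obtain ⟨y, hy⟩ := exists_morphism_phi_eq (t := t) (s := s) v
        rw [morphism_cons, List.append_assoc, ← List.append_assoc (morphism _ v), hy,
          phi_of_eq hc, occ_append, List.append_assoc, occ_append, occ_replicate_iff,
          occ_replicate_iff, List.length_replicate] at ho
        rw [hc]
        exact ho.2.1 _ (by omega) (by omega)
      · rw [morphism_cons, phi_of_ne hc, List.append_assoc, occ_append, occ_append] at ho
        simp only [List.length_append, List.length_replicate, List.length_singleton] at ho
        exact (by simpa using ho.1 : _ ∧ _).2
    subst hc
    rw [morphism_cons, List.append_assoc, occ_append, ← cut_succ] at ho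
    rw [List.cons_append, occ_cons]
    exact ⟨rfl, ih ho.2⟩

theorem ext_morphism_append {v y : List (Fin m)} {x : Fin m} (hx : x ≠ 0)
    (hv : morphism (phi m t s) v ++ List.replicate t 0 = List.replicate t 0 ++ x :: y) :
    ext u (morphism (phi m t s) v ++ List.replicate t 0) =
      (ext u v).image (Prod.map (· + 1) (· + 1)) := by
  ext ⟨a, b⟩
  simp only [Finset.mem_image, Prod.exists, Prod.map_apply, Prod.mk.injEq, mem_ext,
    mem_language_iff]
  constructor
  · rintro ⟨i, hi⟩
    rw [occ_cons] at hi
    obtain ⟨hia, hi⟩ := hi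
    -- The first nonzero letter is preceded by exactly `t` zeros, so the occurrence begins at a cut.
    have hcut : ∃ n, i + 1 = cut (phi m t s) u n := by
      have hi' := hi
      rw [hv, List.append_assoc, occ_append, List.cons_append, occ_cons,
        List.length_replicate] at hi'
      have hxi := hi'.2.1
      obtain ⟨n, hn, -⟩ := h.exists_cut_of_ne_zero (i := i + 1 + t) (hxi ▸ hx)
      exact ⟨n, by omega⟩
    obtain ⟨_ | n, hn⟩ := hcut
    · rw [cut_zero] at hn
      omega
    rw [hn, List.append_assoc] at hi
    refine ⟨u n, b - 1, ⟨n, ?_⟩, ?_, sub_add_cancel b 1⟩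
    · rw [occ_cons]
      exact ⟨rfl, h.occ_of_occ_morphism hi⟩
    · rw [← hia, h.apply_of_add_one_eq_cut hn]
  · rintro ⟨a, b, ⟨j, hj⟩, rfl, rfl⟩
    rw [occ_cons] at hj
    obtain ⟨rfl, hj⟩ := hj
    have hpos : 0 < cut (phi m t s) u (j + 1) := by
      have := List.length_pos_iff.2 (phi_ne_nil (t := t) h.one_le (u j))
      rw [cut_succ]
      omega
    obtain ⟨c, hc⟩ : ∃ c, c + 1 = cut (phi m t s) u (j + 1) :=
      ⟨cut (phi m t s) u (j + 1) - 1, by omega⟩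
    refine ⟨c, ?_⟩
    rw [occ_cons, hc, List.append_assoc]
    exact ⟨h.apply_of_add_one_eq_cut hc, h.occ_morphism_append hj⟩

/-- On factors, `v ↦ φ(v) 0^t` reflects palindromes: two words of the same length with the same
image occur at the same position by synchronization, hence coincide. -/
theorem reverse_eq_iff_of_mem_language {v : List (Fin m)} (hv : v ∈ language u) :
    (morphism (phi m t s) v ++ List.replicate t 0).reverse =
      morphism (phi m t s) v ++ List.replicate t 0 ↔ v.reverse = v := by
  rw [reverse_morphism_phi]
  refine ⟨fun heq => ?_, fun heq => by rw [heq]⟩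
  obtain ⟨b, hb⟩ := exists_append_mem_language hv
  obtain ⟨j, hj⟩ := mem_language_iff.1 hb
  have ho := h.occ_morphism_append hj
  rw [← List.append_assoc, ← heq, List.append_assoc] at ho
  have h1 := h.occ_of_occ_morphism ho
  rw [occ_append] at h1 hj
  exact h1.1.eq_of_length hj.1 (by simp)

/-- A left special factor with a nonzero letter begins with exactly `t` zeros. -/
theorem eq_of_left_special {r : ℕ} {x : Fin m} {y : List (Fin m)} (hx : x ≠ 0)
    {p q : Fin m × Fin m} (hp : p ∈ ext u (List.replicate r 0 ++ x :: y))
    (hq : q ∈ ext u (List.replicate r 0 ++ x :: y)) (hpq : p.1 ≠ q.1) : r = t := by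
  have hmem : ∀ p ∈ ext u (List.replicate r 0 ++ x :: y),
      (p.1, x) ∈ ext u (List.replicate r 0) := fun p hp => by
    rw [mem_ext] at hp ⊢
    exact mem_language_of_append (x := []) (y := y ++ [p.2]) (by simpa using hp)
  have hp := hmem p hp
  have hq := hmem q hq
  have hs := h.one_le
  by_cases hp0 : p.1 = 0
  · have hq0 : q.1 ≠ 0 := fun hq0 => hpq (hp0.trans hq0.symm)
    rw [hp0, h.zero_mem_ext_replicate hx] at hp
    rw [h.mem_ext_replicate_of_ne hq0 hx] at hq
    omega
  · rw [h.mem_ext_replicate_of_ne hp0 hx] at hp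
    by_cases hq0 : q.1 = 0
    · rw [hq0, h.zero_mem_ext_replicate hx] at hq
      omega
    · rw [h.mem_ext_replicate_of_ne hq0 hx] at hq
      rcases hp with hp | hp
      · exact hp.1
      · rcases hq with hq | hq
        · exact hq.1
        · exact absurd (hp.2.1.trans hq.2.1.symm) hpq

omit h in
theorem eq_replicate_or_exists_ne_zero (w : List (Fin m)) :
    w = List.replicate w.length 0 ∨
      ∃ r x y, x ≠ 0 ∧ w = List.replicate r 0 ++ x :: y := by
  induction w with
  | nil => exact Or.inl rfl
  | cons a w ih =>
    by_cases ha : a = 0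
    · subst ha
      rcases ih with hw | ⟨r, x, y, hx, rfl⟩
      · left
        rw [List.length_cons, List.replicate_succ, ← hw]
      · exact Or.inr ⟨r + 1, x, y, hx, by simp [List.replicate_succ]⟩
    · exact Or.inr ⟨0, a, w, ha, rfl⟩

/-- A factor with a nonzero letter that begins and ends with exactly `t` zeros is `φ(v) 0^t` for a
factor `v`: nonzero letters end the images of letters, so `w` begins at a cut and, without its
last `t` letters, ends at a cut. -/
theorem exists_eq_morphism_append {w y y' : List (Fin m)} {x x' : Fin m} (hw : w ∈ language u)
    (hx : x ≠ 0) (hwx : w = List.replicate t 0 ++ x :: y) (hx' : x' ≠ 0)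
    (hwx' : w.reverse = List.replicate t 0 ++ x' :: y') :
    ∃ v ∈ language u, w = morphism (phi m t s) v ++ List.replicate t 0 := by
  obtain ⟨i, hi⟩ := mem_language_iff.1 hw
  have hw' : w = (y'.reverse ++ [x']) ++ List.replicate t 0 := by
    rw [← List.reverse_reverse w, hwx']
    simp
  have hi1 := hi
  rw [hwx, occ_append, occ_cons, List.length_replicate] at hi1
  obtain ⟨n, hn, -⟩ := h.exists_cut_of_ne_zero (hi1.2.1 ▸ hx)
  rw [hw', occ_append] at hi
  have hi2 := hi.1
  rw [occ_append, occ_cons, List.length_reverse] at hi2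
  obtain ⟨k, hk, hke⟩ := h.exists_cut_of_ne_zero (hi2.2.1 ▸ hx')
  have hne : u k + 1 ≠ 0 := by
    rw [hke, hi2.2.1]
    exact hx'
  have hcut := cut_succ_of_ne (t := t) (s := s) hne
  have hmono : Monotone (cut (phi m t s) u) :=
    monotone_nat_of_le_succ fun n => by rw [cut_succ]; exact Nat.le_add_right _ _
  have hnk : n ≤ k := by
    by_contra hlt
    have : cut (phi m t s) u (k + 1) ≤ cut (phi m t s) u n := hmono (by omega)
    omega
  obtain ⟨v, hv, hvl⟩ := exists_occ u n (k + 1 - n)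
  obtain ⟨h1, h2⟩ := occ_morphism h.isFixedPoint hv
  rw [hvl, show n + (k + 1 - n) = k + 1 by omega] at h2
  refine ⟨v, ⟨n, hv⟩, ?_⟩
  rw [hw']
  congr 1
  have hni : cut (phi m t s) u n = i := by omega
  rw [hni] at h1 h2
  refine hi.1.eq_of_length h1 ?_
  simp only [List.length_append, List.length_reverse, List.length_singleton]
  omega

/-- Factors are balanced, by induction on the length: a bispecial factor with a nonzero letter is
`φ(v) 0^t`, and has the extensions of `v` up to a shift of the alphabet. -/
theorem balanced_ext (w : List (Fin m)) (hw : w ∈ language u) :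
    Balanced (ext u w) (w.reverse = w) := by
  induction hl : w.length using Nat.strong_induction_on generalizing w with
  | _ l ih =>
  subst hl
  have hne := ext_nonempty h.reverse_mem_language hw
  have hsymm : w.reverse = w → ∀ a b, (a, b) ∈ ext u w → (b, a) ∈ ext u w := by
    intro hr a b hab
    have := mem_ext_reverse h.reverse_mem_language hab
    rwa [hr] at this
  rcases eq_replicate_or_exists_ne_zero w with hrep | ⟨r, x, y, hx, hwx⟩
  · rw [hrep] at hw ⊢
    rw [eq_true (List.reverse_replicate)]
    exact h.balanced_replicate hw
  by_cases hleft : ∀ p ∈ ext u w, ∀ q ∈ ext u w, p.1 = q.1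
  · exact balanced_of_subsingleton_fst hne hsymm hleft
  by_cases hright : ∀ p ∈ ext u w, ∀ q ∈ ext u w, p.2 = q.2
  · exact balanced_of_subsingleton_snd hne hsymm hright
  push Not at hleft hright
  obtain ⟨p, hp, q, hq, hpq⟩ := hleft
  obtain ⟨p', hp', q', hq', hpq'⟩ := hright
  have hrt : r = t := by
    rw [hwx] at hp hq
    exact h.eq_of_left_special hx hp hq hpq
  subst hrt
  rcases eq_replicate_or_exists_ne_zero w.reverse with hrep | ⟨r', x', y', hx', hwx'⟩
  · have hxw : x ∈ w.reverse := by simp [hwx]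
    rw [hrep] at hxw
    exact absurd (List.eq_of_mem_replicate hxw) hx
  have hrt' : r' = r := by
    have hp2 := mem_ext_reverse h.reverse_mem_language hp'
    have hq2 := mem_ext_reverse h.reverse_mem_language hq'
    rw [hwx'] at hp2 hq2
    exact h.eq_of_left_special hx' hp2 hq2 hpq'
  subst hrt'
  obtain ⟨v, hv, rfl⟩ := h.exists_eq_morphism_append hw hx hwx hx' hwx'
  rw [h.ext_morphism_append hx hwx, propext (h.reverse_eq_iff_of_mem_language hv)]
  have hlen := length_le_length_morphism (phi_ne_nil (t := r') h.one_le) v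
  have ht := h.one_le.trans h.le
  refine Balanced.image_prodMap (f := (· + 1)) (Equiv.addRight (1 : Fin m)).bijective
    (ih _ ?_ v hv rfl)
  rw [List.length_append, List.length_replicate]
  omega

end IsParryWord

/-! ### The identity between the two complexities -/

theorem existsUnique_isFixedPoint_phi {m t s : ℕ} [NeZero m] (hs : 1 ≤ s) (hst : s ≤ t)
    (h1 : (1 : Fin m) ≠ 0) : ∃! u : ℕ → Fin m, IsFixedPoint (phi m t s) u := by
  have ha := singleton_zero_prefix_phi hs hst (0 : Fin m)
  have hσ := phi_ne_nil (m := m) (t := t) hs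
  have h2 := IsParryWord.two_le_length_phi_zero (s := s) h1 (hs.trans hst)
  obtain ⟨u, hu⟩ := exists_isFixedPoint hσ ha h2
  exact ⟨u, hu, fun v hv => hv.unique hσ ha h2 (hv.apply_zero hs hst) hu (hu.apply_zero hs hst)⟩

section Subsingleton

variable {A : Type*} [Subsingleton A] {u : ℕ → A}

theorem eq_of_length_eq {v w : List A} (h : v.length = w.length) : v = w :=
  List.ext_getElem h fun _ _ _ => Subsingleton.elim _ _

theorem mem_language_of_subsingleton (w : List A) : w ∈ language u :=
  ⟨0, eq_of_length_eq (by simp)⟩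

theorem factorComplexity_of_subsingleton (n : ℕ) : factorComplexity u n = 1 := by
  refine Set.ncard_eq_one.2 ⟨pref u n, Set.eq_singleton_iff_unique_mem.2 ⟨?_, ?_⟩⟩
  · exact ⟨mem_language_of_subsingleton _, length_pref n⟩
  · exact fun w hw => eq_of_length_eq (hw.2.trans (length_pref n).symm)

theorem palindromicComplexity_of_subsingleton (n : ℕ) : palindromicComplexity u n = 1 := by
  refine Set.ncard_eq_one.2 ⟨pref u n, Set.eq_singleton_iff_unique_mem.2 ⟨?_, ?_⟩⟩
  · exact ⟨⟨mem_language_of_subsingleton _, eq_of_length_eq (by simp)⟩, length_pref n⟩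
  · exact fun w hw => eq_of_length_eq (hw.2.trans (length_pref n).symm)

end Subsingleton

end SubstWord

theorem mainTheorem1 (m t s : ℕ) [NeZero m] (hs : 1 ≤ s) (hst : s ≤ t) :
    (∃! u : ℕ → Fin m, SubstWord.IsFixedPoint (SubstWord.phi m t s) u) ∧
    ∀ u : ℕ → Fin m, SubstWord.IsFixedPoint (SubstWord.phi m t s) u →
      ∀ n : ℕ,
        (SubstWord.palindromicComplexity u (n + 1) : ℤ) + SubstWord.palindromicComplexity u n =
          (SubstWord.factorComplexity u (n + 1) : ℤ) - SubstWord.factorComplexity u n + 2 := by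
  by_cases h1 : (1 : Fin m) = 0
  · have hsub : Subsingleton (Fin m) := by
      refine Fin.subsingleton_iff_le_one.2 (not_lt.1 fun hm => ?_)
      rw [Fin.ext_iff, Fin.val_one', Fin.val_zero, Nat.mod_eq_of_lt hm] at h1
      exact one_ne_zero h1
    refine ⟨⟨fun _ => 0, fun n => SubstWord.eq_of_length_eq (by simp),
      fun v _ => Subsingleton.elim _ _⟩, fun u _ n => ?_⟩
    simp [SubstWord.factorComplexity_of_subsingleton,
      SubstWord.palindromicComplexity_of_subsingleton]
  · refine ⟨SubstWord.existsUnique_isFixedPoint_phi hs hst h1, fun u hu n => ?_⟩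
    have h : SubstWord.IsParryWord m t s u := ⟨hs, hst, h1, hu⟩
    exact SubstWord.palindromicComplexity_add_of_balanced h.reverse_mem_language h.balanced_ext n
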